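/- Let $m\ge 2$, $n\ge 1$. A gamble on $k$ prizes is a block-diagonal matrix $G=\mathrm{Diag}(G_1,\dots,G_k)$ with $n\times n$ Hermitian blocks; let $\mathcal G_k$ be the space of these. Write $G\gneq 0$ if $G$ is positive semidefinite and non-zero. A measurement is a family $\Pi=\{\Pi_i\}_{i=1}^n$ of rank-one, mutually orthogonal projections on $\mathbb C^n$ with $\sum_i\Pi_i=I_n$. A quantum horse lottery is a $Q\in\mathcal G_m$ such that for every measurement $\Pi$ and every $i$ there is a probability mass function (pmf) $p$ on $\{1,\dots,m\}$, regarded as a diagonal matrix, with $(I_m\otimes\Pi_i)Q(I_m\otimes\Pi_i)=p\otimes\Pi_i$; let $\mathsf{QL}$ be the set of these. Let $Z=p_z\otimes I_n$, where $p_z$ puts all its mass on the last prize, and let $\mathsf{Proj}(G)=\mathrm{Diag}(G_1,\dots,G_{m-1})$. Say that $P$ is objectively preferred to $Q$, $P\rhd Q$, if $\mathsf{Proj}(P-Q)\gneq 0$. Consider relations $\succ$ on $\mathsf{QL}$ that are * coherent: $\succ$ is irreflexive and transitive, and $P\succ Q\Leftrightarrow\alpha P+(1-\alpha)R\succ\alpha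 Q+(1-\alpha)R$ for all $P,Q,R\in\mathsf{QL}$ and $\alpha\in(0,1]$; moreover $Z$ is the worst outcome, i.e. $P\succ Z$ for all $P\ne Z$; * weakly Archimedean: if $P\succ Q$ and not $P\rhd Q$, then $\alpha P+(1-\alpha)Z\succ Q$ for some $\alpha\in(0,1)$. Such a relation is called complete if it is maximal, i.e. not properly included in another such relation. (This is the case, in particular, if $P\succ Q$ or $Q\succ P$ for all $P\neq Q$.) Put $\mathcal K=\{\lambda\,\mathsf{Proj}(P-Q):P\succ Q,\ \lambda>0\}$ and, for a projection $E$ on $\mathbb{C}^n$, $\mathcal K_{E}=\{G\in\mathcal G_{m-1}: G\gneq 0\text{ or }(I_{m-1}\otimes E)G(I_{m-1}\otimes E)\in\mathcal K\}$. The relation satisfies epistemic irrelevance if, for every measurement $\Pi$, every $i$ and every real diagonal $(m-1)\times(m-1)$ matrix $g$: $\ g\otimes I_n\in\mathcal K\Leftrightarrow g\otimes I_n\in\mathcal K_{\Pi_i}$. **Corollary.** Let $\succ$ be a complete, weakly Archimedean, coherent preference relation (with worst outcome $Z$) that satisfies epistemic irrelevance. Then there is a unique positive semidefinite trace-one $R\in\mathcal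 G_{m-1}$ such that, for all $P,Q\in\mathsf{QL}$, $$P\succ Q\iff P\rhd Q\ \text{ or }\ \mathrm{Tr}(\mathsf{Proj}(P)^\dagger R)>\mathrm{Tr}(\mathsf{Proj}(Q)^\dagger R),$$ and it factorizes as $R=p\otimes\rho$ with $p=\mathrm{Diag}(p_1,\dots,p_{m-1})$ a pmf and $\rho$ an $n\times n$ density matrix. Thus, for all $P,Q\in\mathsf{QL}$, $$P\succ Q\iff P\rhd Q\ \text{ or }\ \mathrm{Tr}\Big(\big(\textstyle\sum_{i=1}^{m-1}p_iP_i^\dagger\big)\rho\Big)>\mathrm{Tr}\Big(\big(\sum_{i=1}^{m-1}p_iQ_i^\dagger\big)\rho\Big),$$ and the pair $(p,\rho)$ is the only pair of a pmf and a density matrix with this last property. -/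

import Mathlib

open scoped Matrix ComplexOrder
open scoped Kronecker

namespace QuantumPref

/-- The diagonal matrix (with complex entries) of a real vector. -/
def diagC {k : ℕ} (g : Fin k → ℝ) : Matrix (Fin k) (Fin k) ℂ :=
  Matrix.diagonal fun i => (g i : ℂ)

/-- `G ⪈ 0`: positive semidefinite and non-zero. -/
def PSDNZ {ι : Type*} [Fintype ι] (G : Matrix ι ι ℂ) : Prop :=
  G.PosSemidef ∧ G ≠ 0

/-- Density matrices: positive semidefinite matrices of trace one. -/
def IsDensity {ι : Type*} [Fintype ι] (A : Matrix ι ι ℂ) : Prop :=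
  A.PosSemidef ∧ A.trace = 1

/-- The space of gambles (real diagonal `k × k` matrices tensor Hermitian `n × n` matrices), that is,
the block-diagonal matrices with `k` Hermitian blocks of size `n`. -/
def IsGamble {k n : ℕ} (G : Matrix (Fin k × Fin n) (Fin k × Fin n) ℂ) : Prop :=
  G.IsHermitian ∧ ∀ i j a b, i ≠ j → G (i, a) (j, b) = 0

/-- The `i`-th diagonal block. -/
def block {k n : ℕ} (G : Matrix (Fin k × Fin n) (Fin k × Fin n) ℂ) (i : Fin k) :
    Matrix (Fin n) (Fin n) ℂ :=
  Matrix.of fun a b => G (i, a) (i, b)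

/-- A projection measurement along `n` orthogonal directions of `ℂⁿ`. -/
structure IsMeasurement {n : ℕ} (Pi : Fin n → Matrix (Fin n) (Fin n) ℂ) : Prop where
  posSemidef : ∀ i, (Pi i).PosSemidef
  idem : ∀ i, Pi i * Pi i = Pi i
  orth : ∀ i j, i ≠ j → Pi i * Pi j = 0
  rank_one : ∀ i, (Pi i).rank = 1
  sum_eq_one : ∑ i, Pi i = 1

/-- `(I ⊗ E) G (I ⊗ E)`. -/
def compress {k n : ℕ} (E : Matrix (Fin n) (Fin n) ℂ)
    (G : Matrix (Fin k × Fin n) (Fin k × Fin n) ℂ) :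
    Matrix (Fin k × Fin n) (Fin k × Fin n) ℂ :=
  ((1 : Matrix (Fin k) (Fin k) ℂ) ⊗ₖ E) * G * ((1 : Matrix (Fin k) (Fin k) ℂ) ⊗ₖ E)

/-- Quantum horse lotteries over `m` prizes: gambles that return a pmf on the prizes whenever a
measurement is performed and one of its projectors is observed. -/
def IsQHLottery {m n : ℕ} (Q : Matrix (Fin m × Fin n) (Fin m × Fin n) ℂ) : Prop :=
  IsGamble Q ∧ ∀ Pi : Fin n → Matrix (Fin n) (Fin n) ℂ, IsMeasurement Pi →
    ∀ i, ∃ p ∈ stdSimplex ℝ (Fin m), compress (Pi i) Q = diagC p ⊗ₖ Pi i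

/-- The set of quantum horse lotteries over the prizes `Fin (k + 1)`; the last prize
`Fin.last k` is the worst outcome `z`, and the first `k` are the actual prizes (so `k = m - 1`). -/
def QL (k n : ℕ) : Type :=
  {Q : Matrix (Fin (k + 1) × Fin n) (Fin (k + 1) × Fin n) ℂ // IsQHLottery Q}

/-- The convex combination `α P + (1 - α) Q` of two lotteries. -/
noncomputable def mix {k n : ℕ} (α : unitInterval) (P Q : QL k n) : QL k n :=
  ⟨(α : ℝ) • P.1 + (1 - (α : ℝ)) • Q.1, by
    obtain ⟨⟨hP, hP0⟩, hPm⟩ := P.2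
    obtain ⟨⟨hQ, hQ0⟩, hQm⟩ := Q.2
    refine ⟨⟨?_, ?_⟩, ?_⟩
    · unfold Matrix.IsHermitian at *
      rw [Matrix.conjTranspose_add, Matrix.conjTranspose_smul, Matrix.conjTranspose_smul, hP, hQ]
      simp
    · intro i j a b hij
      simp [hP0 i j a b hij, hQ0 i j a b hij]
    · intro Pi hPi i
      obtain ⟨p, hp, hpe⟩ := hPm Pi hPi i
      obtain ⟨q, hq, hqe⟩ := hQm Pi hPi i
      refine ⟨(α : ℝ) • p + (1 - (α : ℝ)) • q,
        convex_stdSimplex ℝ _ hp hq α.2.1 (sub_nonneg.2 α.2.2) (by ring), ?_⟩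
      have h1 : compress (Pi i) ((α : ℝ) • P.1 + (1 - (α : ℝ)) • Q.1)
          = (α : ℝ) • compress (Pi i) P.1 + (1 - (α : ℝ)) • compress (Pi i) Q.1 := by
        simp only [compress, Matrix.mul_add, Matrix.add_mul, Matrix.mul_smul, Matrix.smul_mul]
      rw [h1, hpe, hqe]
      ext ⟨a, b⟩ ⟨c, d⟩
      by_cases hac : a = c
      · subst hac
        simp [diagC, Matrix.kroneckerMap_apply]
        ring
      · simp [diagC, Matrix.kroneckerMap_apply, hac]⟩

/-- The lottery `Z = p_z ⊗ I` that yields the worst outcome `z` for sure. -/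
noncomputable def Z (k n : ℕ) : QL k n :=
  ⟨diagC (Pi.single (Fin.last k) 1) ⊗ₖ (1 : Matrix (Fin n) (Fin n) ℂ), by
    refine ⟨⟨?_, ?_⟩, ?_⟩
    · unfold Matrix.IsHermitian
      rw [Matrix.conjTranspose_kronecker, Matrix.conjTranspose_one]
      congr 1
      ext i j
      by_cases h : i = j
      · subst h; simp [diagC]
      · simp [diagC, h, Ne.symm h]
    · intro i j a b hij
      simp [diagC, Matrix.kroneckerMap_apply, hij]
    · intro P hP i
      refine ⟨Pi.single (Fin.last k) 1, single_mem_stdSimplex ℝ _, ?_⟩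
      simp only [compress]
      rw [← Matrix.mul_kronecker_mul, ← Matrix.mul_kronecker_mul]
      simp [hP.idem i]⟩

/-- The projection that drops the `z`-block. -/
def proj {k n : ℕ} (G : Matrix (Fin (k + 1) × Fin n) (Fin (k + 1) × Fin n) ℂ) :
    Matrix (Fin k × Fin n) (Fin k × Fin n) ℂ :=
  G.submatrix (Prod.map Fin.castSucc id) (Prod.map Fin.castSucc id)

/-- `P` is objectively preferred to `Q`. -/
def ObjPref {k n : ℕ} (P Q : QL k n) : Prop :=
  PSDNZ (proj (P.1 - Q.1))

/-- Coherence: strict partial order, and mixture independence. -/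
structure IsCoherent {k n : ℕ} (succ : QL k n → QL k n → Prop) : Prop where
  irrefl : ∀ P, ¬ succ P P
  trans : ∀ P Q R, succ P Q → succ Q R → succ P R
  mixture : ∀ (P Q R : QL k n) (α : unitInterval), 0 < α →
    (succ P Q ↔ succ (mix α P R) (mix α Q R))

/-- The prize `z` is the worst outcome. -/
def HasWorst {k n : ℕ} (succ : QL k n → QL k n → Prop) : Prop :=
  ∀ P, P ≠ Z k n → succ P (Z k n)

/-- Weak Archimedeanity. -/
def IsWeaklyArchimedean {k n : ℕ} (succ : QL k n → QL k n → Prop) : Prop :=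
  ∀ P Q, succ P Q → ¬ ObjPref P Q → ∃ α : unitInterval, 0 < α ∧ α < 1 ∧ succ (mix α P (Z k n)) Q

/-- Weakly Archimedean coherent preference relations with worst outcome `z`. -/
structure IsWACoherent {k n : ℕ} (succ : QL k n → QL k n → Prop) : Prop where
  coherent : IsCoherent succ
  worst : HasWorst succ
  archimedean : IsWeaklyArchimedean succ

/-- Complete weakly Archimedean coherent preference relations: those that are not properly
included in another weakly Archimedean coherent preference relation. (They correspond to the
maximal sets of strictly desirable gambles.) -/
structure IsCompleteWACoherent {k n : ℕ} (succ : QL k n → QL k n → Prop) : Prop where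
  waCoherent : IsWACoherent succ
  maximal : ∀ succ' : QL k n → QL k n → Prop, IsWACoherent succ' →
    (∀ P Q, succ P Q → succ' P Q) → ∀ P Q, succ' P Q → succ P Q

/-- A weakly Archimedean coherent relation that compares any two distinct lotteries is complete. -/
theorem IsCompleteWACoherent.of_total {k n : ℕ} {succ : QL k n → QL k n → Prop}
    (h : IsWACoherent succ) (ht : ∀ P Q, P ≠ Q → succ P Q ∨ succ Q P) :
    IsCompleteWACoherent succ := by
  refine ⟨h, fun succ' h' hle P Q hPQ => ?_⟩
  have hne : P ≠ Q := by
    rintro rfl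
    exact h'.coherent.irrefl _ hPQ
  rcases ht P Q hne with h1 | h1
  · exact h1
  · exact absurd (h'.coherent.trans _ _ _ hPQ (hle _ _ h1)) (h'.coherent.irrefl P)

/-- The set of desirable gambles of a preference relation. -/
def desirable {k n : ℕ} (succ : QL k n → QL k n → Prop) :
    Set (Matrix (Fin k × Fin n) (Fin k × Fin n) ℂ) :=
  {G | ∃ (c : ℝ) (P Q : QL k n), 0 < c ∧ succ P Q ∧ G = c • proj (P.1 - Q.1)}

/-- The set of desirable gambles conditional on the event indicated by the projector `E`. -/
def conditional {k n : ℕ} (K : Set (Matrix (Fin k × Fin n) (Fin k × Fin n) ℂ))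
    (E : Matrix (Fin n) (Fin n) ℂ) : Set (Matrix (Fin k × Fin n) (Fin k × Fin n) ℂ) :=
  {G | IsGamble G ∧ (PSDNZ G ∨ compress E G ∈ K)}

/-- The marginal on the prize subsystem; a real diagonal matrix is given by its diagonal. -/
def marg {k n : ℕ} (K : Set (Matrix (Fin k × Fin n) (Fin k × Fin n) ℂ)) : Set (Fin k → ℝ) :=
  {g | diagC g ⊗ₖ (1 : Matrix (Fin n) (Fin n) ℂ) ∈ K}

/-- Epistemic irrelevance: observing an event of the quantum system never changes the
marginal set of desirable gambles on the prizes. -/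
def EpistemicIrrelevance {k n : ℕ} (succ : QL k n → QL k n → Prop) : Prop :=
  ∀ Pi : Fin n → Matrix (Fin n) (Fin n) ℂ, IsMeasurement Pi →
    ∀ i, marg (desirable succ) = marg (conditional (desirable succ) (Pi i))

/-- The trace-one positive matrices in the space of gambles over the actual prizes. -/
def IsState {k n : ℕ} (R : Matrix (Fin k × Fin n) (Fin k × Fin n) ℂ) : Prop :=
  IsGamble R ∧ IsDensity R

/-- `R` represents the relation: `P ≻ Q` iff `P` is objectively preferred to `Q` or
`Tr(Proj(P)† R) > Tr(Proj(Q)† R)` (these traces are real). -/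
def IsRepresentedBy {k n : ℕ} (succ : QL k n → QL k n → Prop)
    (R : Matrix (Fin k × Fin n) (Fin k × Fin n) ℂ) : Prop :=
  ∀ P Q, succ P Q ↔
    (ObjPref P Q ∨ ((proj P.1)ᴴ * R).trace.re > ((proj Q.1)ᴴ * R).trace.re)

/-- The utility `∑ pᵢ Pᵢ†` of a lottery, the sum being over the actual prizes. -/
noncomputable def utility {k n : ℕ} (p : Fin k → ℝ) (P : QL k n) : Matrix (Fin n) (Fin n) ℂ :=
  ∑ i, p i • (block P.1 i.castSucc)ᴴ

/-- State-independent expected utility representation (these traces are real). -/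
def RepresentsSI {k n : ℕ} (succ : QL k n → QL k n → Prop)
    (p : Fin k → ℝ) (ρ : Matrix (Fin n) (Fin n) ℂ) : Prop :=
  ∀ P Q, succ P Q ↔
    (ObjPref P Q ∨ (utility p P * ρ).trace.re > (utility p Q * ρ).trace.re)

end QuantumPref

open QuantumPref

namespace QuantumPref

/-! ### Positive semidefinite matrices, quadratic forms and rank-one projections -/

section MatrixLemmas

variable {ι : Type*}

/-! A preference relation is encoded by its convex cone `desirable succ`: mixture independence and
transitivity make it a cone that decides every comparison (`IsCoherent.succ_iff_mem_desirable`),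
irreflexivity keeps 0 out, and the worst outcome puts all non-zero positive gambles in.

M. Riesz extension from the line of multiples of 1 yields a normalized functional that is
nonnegative on the cone, i.e. Re Tr(G R) for a state R (`exists_functional`, `exists_state`). By
weak Archimedeanity a desirable G that is not positive stays desirable after subtracting some ε•1,
so its expectation is strictly positive. Hence the relation lies inside `stateRel R`, itself weakly
Archimedean and coherent, and maximality makes the two equal.

Uniqueness and factorization both rest on `eq_mul_of_forall_pos_imp_nonneg`: a functional that is
nonnegative wherever another is positive is a multiple of it. Two states representing one relation
thus agree on gambles. Under irrelevance, g ↦ Tr((g ⊗ Π_i) R) is proportional to g ↦ Tr((g ⊗ I) R).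
As Π_i may project onto any unit vector, comparing quadratic forms gives R_i = Tr(R_i) ∑ R_j, which
is the product form. -/

theorem _root_.Matrix.PosSemidef.real_smul {A : Matrix ι ι ℂ} (hA : A.PosSemidef) {c : ℝ}
    (hc : 0 ≤ c) : (c • A).PosSemidef := by
  have := hA.smul (a := (c : ℂ)) (Complex.zero_le_real.mpr hc)
  simpa using this

theorem _root_.Matrix.IsHermitian.real_smul {A : Matrix ι ι ℂ} (hA : A.IsHermitian) (c : ℝ) :
    (c • A).IsHermitian := by
  unfold Matrix.IsHermitian at *
  rw [Matrix.conjTranspose_smul, hA]; simp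

open scoped MatrixOrder in
theorem eq_zero_of_posSemidef_of_neg {A : Matrix ι ι ℂ} (h₁ : A.PosSemidef)
    (h₂ : (-A).PosSemidef) : A = 0 :=
  le_antisymm (by simpa [Matrix.le_iff] using h₂) (by simpa [Matrix.le_iff] using h₁)

variable [Fintype ι]

/-- Writing B = C*C, cyclicity turns the trace into that of C A C*. -/
theorem _root_.Matrix.PosSemidef.trace_mul_nonneg {A B : Matrix ι ι ℂ} (hA : A.PosSemidef)
    (hB : B.PosSemidef) : 0 ≤ (A * B).trace := by
  classical
  open scoped MatrixOrder in
  obtain ⟨C, rfl⟩ := CStarAlgebra.nonneg_iff_eq_star_mul_self.mp hB.nonneg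
  rw [← Matrix.mul_assoc, Matrix.trace_mul_comm, ← Matrix.mul_assoc]
  exact (hA.mul_mul_conjTranspose_same C).trace_nonneg

theorem _root_.Matrix.PosSemidef.trace_mul_re_nonneg {A B : Matrix ι ι ℂ} (hA : A.PosSemidef)
    (hB : B.PosSemidef) : 0 ≤ (A * B).trace.re :=
  (Complex.nonneg_iff.mp (hA.trace_mul_nonneg hB)).1

open scoped MatrixOrder Matrix.Norms.L2Operator in
theorem exists_smul_one_sub_posSemidef [DecidableEq ι] {A : Matrix ι ι ℂ} (hA : A.IsHermitian) :
    ∃ t : ℝ, 0 < t ∧ (t • (1 : Matrix ι ι ℂ) - A).PosSemidef := by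
  -- The summand 1 keeps the bound strictly positive when A = 0.
  refine ⟨‖A‖ + 1, by positivity, ?_⟩
  have h : A ≤ algebraMap ℝ (Matrix ι ι ℂ) ‖A‖ := IsSelfAdjoint.le_algebraMap_norm_self hA
  rw [Matrix.le_iff, Algebra.algebraMap_eq_smul_one] at h
  have e : (‖A‖ + 1) • (1 : Matrix ι ι ℂ) - A = ‖A‖ • 1 - A + 1 := by
    rw [add_smul, one_smul]; abel
  rw [e]
  exact h.add Matrix.PosSemidef.one

/-- Two-sided bound of a Hermitian matrix by a multiple of the identity. -/
theorem exists_smul_one_sub_add_posSemidef [DecidableEq ι] {A : Matrix ι ι ℂ}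
    (hA : A.IsHermitian) :
    ∃ t : ℝ, 0 < t ∧ (t • (1 : Matrix ι ι ℂ) - A).PosSemidef ∧
      (t • (1 : Matrix ι ι ℂ) + A).PosSemidef := by
  obtain ⟨s, hs, h1⟩ := exists_smul_one_sub_posSemidef hA
  obtain ⟨t, ht, h2⟩ := exists_smul_one_sub_posSemidef hA.neg
  refine ⟨s + t, by positivity, ?_, ?_⟩
  · convert h1.add (Matrix.PosSemidef.one.real_smul ht.le) using 1
    rw [add_smul]; abel
  · convert h2.add (Matrix.PosSemidef.one.real_smul hs.le) using 1
    rw [add_smul]; abel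

theorem star_dotProduct_mulVec_smul (A : Matrix ι ι ℂ) (c : ℂ) (v : ι → ℂ) :
    star (c • v) ⬝ᵥ (A *ᵥ (c • v)) = (star c * c) * (star v ⬝ᵥ (A *ᵥ v)) := by
  simp only [star_smul, Matrix.mulVec_smul, smul_dotProduct, dotProduct_smul, smul_eq_mul]
  ring

/-- Every non-zero vector is a multiple of a unit vector. -/
theorem exists_unit_smul {v : ι → ℂ} (hv : v ≠ 0) :
    ∃ (c : ℂ) (u : ι → ℂ), star u ⬝ᵥ u = 1 ∧ v = c • u := by
  have hw : WithLp.toLp 2 v ≠ 0 := fun h => hv (by simpa using h)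
  have hn : ‖WithLp.toLp 2 v‖ ≠ 0 := norm_ne_zero_iff.mpr hw
  refine ⟨(‖WithLp.toLp 2 v‖ : ℂ), ((‖WithLp.toLp 2 v‖ : ℂ))⁻¹ • v, ?_, ?_⟩
  · have h : star v ⬝ᵥ v = ((‖WithLp.toLp 2 v‖ : ℂ)) ^ 2 := by
      have := inner_self_eq_norm_sq_to_K (𝕜 := ℂ) (WithLp.toLp 2 v)
      rw [EuclideanSpace.inner_toLp_toLp, dotProduct_comm] at this
      exact this
    simp only [star_smul, smul_dotProduct, dotProduct_smul, smul_eq_mul, h]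
    have : (‖WithLp.toLp 2 v‖ : ℂ) ≠ 0 := by exact_mod_cast hn
    simp
    field_simp
  · rw [smul_smul, mul_inv_cancel₀ (by exact_mod_cast hn), one_smul]

/-- Complex polarization; this is why A need not be Hermitian. -/
theorem eq_zero_of_star_dotProduct_mulVec {A : Matrix ι ι ℂ}
    (h : ∀ v, star v ⬝ᵥ (A *ᵥ v) = 0) : A = 0 := by
  classical
  have hl : Matrix.toEuclideanLin A = 0 := by
    rw [← inner_map_self_eq_zero]
    intro x
    have := h (WithLp.ofLp x)
    rw [← inner_conj_symm]
    simp only [EuclideanSpace.inner_eq_star_dotProduct, Matrix.ofLp_toLpLin, Matrix.toLin'_apply]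
    rw [dotProduct_comm, this, map_zero]
  exact (LinearEquiv.map_eq_zero_iff _).mp hl

/-- A matrix is determined by its quadratic form on unit vectors. -/
theorem eq_of_unit_star_dotProduct {A B : Matrix ι ι ℂ}
    (h : ∀ u, star u ⬝ᵥ u = 1 → star u ⬝ᵥ (A *ᵥ u) = star u ⬝ᵥ (B *ᵥ u)) : A = B := by
  rw [← sub_eq_zero]
  apply eq_zero_of_star_dotProduct_mulVec
  intro v
  by_cases hv : v = 0
  · simp [hv]
  obtain ⟨c, u, hu, rfl⟩ := exists_unit_smul hv
  rw [star_dotProduct_mulVec_smul, Matrix.sub_mulVec, dotProduct_sub, h u hu]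
  simp

theorem trace_vecMulVec_star_mul (A : Matrix ι ι ℂ) (v : ι → ℂ) :
    (Matrix.vecMulVec v (star v) * A).trace = star v ⬝ᵥ (A *ᵥ v) := by
  rw [Matrix.trace_mul_comm, Matrix.mul_vecMulVec, Matrix.trace_vecMulVec, dotProduct_comm]

/-- Matrices of rank at most one are outer products. -/
theorem exists_eq_vecMulVec_of_rank_eq_one [DecidableEq ι] {A : Matrix ι ι ℂ} (h : A.rank = 1) :
    ∃ u w : ι → ℂ, A = Matrix.vecMulVec u w := by
  rw [Matrix.rank] at h
  obtain ⟨u, -, hu⟩ := finrank_eq_one_iff'.mp h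
  choose w hw using fun j => hu ⟨A *ᵥ Pi.single j 1, ⟨Pi.single j 1, rfl⟩⟩
  refine ⟨u, w, ?_⟩
  ext i j
  have := congrFun (congrArg Subtype.val (hw j)) i
  simp only [Matrix.mulVec_single_one] at this
  rw [Matrix.vecMulVec_apply, mul_comm]
  exact this.symm

/-- Compression by a rank-one matrix. -/
theorem mul_mul_eq_trace_smul_of_rank_eq_one [DecidableEq ι] {E : Matrix ι ι ℂ} (h : E.rank = 1)
    (M : Matrix ι ι ℂ) : E * M * E = (E * M).trace • E := by
  obtain ⟨u, w, rfl⟩ := exists_eq_vecMulVec_of_rank_eq_one h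
  rw [Matrix.vecMulVec_mul, Matrix.vecMulVec_mul_vecMulVec, Matrix.trace_vecMulVec,
    dotProduct_comm, Matrix.vecMulVec_smul]

/-- Compressing E by itself gives E = E³ = (Tr E) E. -/
theorem trace_eq_one_of_idem_of_rank_eq_one [DecidableEq ι] {E : Matrix ι ι ℂ} (h : E.rank = 1)
    (hE : E * E = E) : E.trace = 1 := by
  have h1 := mul_mul_eq_trace_smul_of_rank_eq_one h E
  rw [hE, hE] at h1
  have h0 : E ≠ 0 := by rintro rfl; simp at h
  have h2 : (1 - E.trace) • E = 0 := by rw [sub_smul, one_smul, ← h1, sub_self]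
  rcases smul_eq_zero.mp h2 with h3 | h3
  · exact (sub_eq_zero.mp h3).symm
  · exact absurd h3 h0

end MatrixLemmas

/-- Every unit vector is one of the directions of a measurement. -/
theorem exists_isMeasurement {n : ℕ} {v : Fin n → ℂ} (hv : star v ⬝ᵥ v = 1) :
    ∃ (E : Fin n → Matrix (Fin n) (Fin n) ℂ) (i : Fin n),
      IsMeasurement E ∧ E i = Matrix.vecMulVec v (star v) := by
  have hn : 0 < n := by
    rcases Nat.eq_zero_or_pos n with rfl | h
    · simp [dotProduct] at hv
    · exact h
  let i₀ : Fin n := ⟨0, hn⟩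
  have hin (x y : EuclideanSpace ℂ (Fin n)) :
      inner ℂ x y = star (WithLp.ofLp x) ⬝ᵥ WithLp.ofLp y := by
    rw [EuclideanSpace.inner_eq_star_dotProduct, dotProduct_comm]
  -- A one-element orthonormal family, to be completed to a basis b with b i₀ = v.
  have ho : Orthonormal ℂ (({i₀} : Set (Fin n)).domRestrict fun _ => WithLp.toLp 2 v) := by
    rw [orthonormal_iff_ite]
    intro i j
    rw [if_pos (Subsingleton.elim i j)]
    exact (hin _ _).trans hv
  obtain ⟨b, hb⟩ := ho.exists_orthonormalBasis_extension_of_card_eq (by simp)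
  have hbb (i j : Fin n) : star (WithLp.ofLp (b i)) ⬝ᵥ WithLp.ofLp (b j) =
      if i = j then 1 else 0 := by
    rw [← hin, orthonormal_iff_ite.mp b.orthonormal i j]
  have hmul (i j : Fin n) : Matrix.vecMulVec (WithLp.ofLp (b i)) (star (WithLp.ofLp (b i))) *
      Matrix.vecMulVec (WithLp.ofLp (b j)) (star (WithLp.ofLp (b j))) =
      (if i = j then (1 : ℂ) else 0) •
        Matrix.vecMulVec (WithLp.ofLp (b i)) (star (WithLp.ofLp (b j))) := by
    rw [Matrix.vecMulVec_mul_vecMulVec, hbb, Matrix.vecMulVec_smul]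
  refine ⟨fun i => Matrix.vecMulVec (WithLp.ofLp (b i)) (star (WithLp.ofLp (b i))), i₀,
    ⟨fun i => Matrix.posSemidef_vecMulVec_self_star _, fun i => ?_, fun i j hij => ?_,
      fun i => ?_, ?_⟩, ?_⟩
  · simp [hmul]
  · simp [hmul, hij]
  · refine le_antisymm (Matrix.rank_vecMulVec_le _ _) (Nat.one_le_iff_ne_zero.mpr fun h0 => ?_)
    rw [Matrix.rank, Submodule.finrank_eq_zero, LinearMap.range_eq_bot] at h0
    replace h0 := (Matrix.toLin' (R := ℂ)).map_eq_zero_iff.mp h0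
    have h1 := hbb i i
    rw [dotProduct_comm, ← Matrix.trace_vecMulVec, h0] at h1
    simp at h1
  -- On quadratic forms, completeness of the projections is Parseval's identity.
  · apply eq_of_unit_star_dotProduct
    intro u _
    rw [Matrix.sum_mulVec, dotProduct_sum, Matrix.one_mulVec]
    have := b.sum_inner_mul_inner (WithLp.toLp 2 u) (WithLp.toLp 2 u)
    simp only [hin] at this
    rw [← this]
    refine Finset.sum_congr rfl fun i _ => ?_
    rw [Matrix.vecMulVec_mulVec]
    simp [dotProduct_smul, mul_comm]
  · simp only [hb i₀ rfl]

/-! ### Calculus of block-diagonal matrices -/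

section Blocks

variable {k n : ℕ}

/-- The block-diagonal matrix with given blocks. -/
def ofBlocks (A : Fin k → Matrix (Fin n) (Fin n) ℂ) : Matrix (Fin k × Fin n) (Fin k × Fin n) ℂ :=
  Matrix.of fun x y => if x.1 = y.1 then A x.1 x.2 y.2 else 0

theorem ofBlocks_apply (A : Fin k → Matrix (Fin n) (Fin n) ℂ) (x y : Fin k × Fin n) :
    ofBlocks A x y = if x.1 = y.1 then A x.1 x.2 y.2 else 0 := rfl

@[simp]
theorem block_ofBlocks (A : Fin k → Matrix (Fin n) (Fin n) ℂ) (i : Fin k) :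
    block (ofBlocks A) i = A i := by
  ext a b
  simp [block, ofBlocks_apply]

theorem IsGamble.ofBlocks_block {G : Matrix (Fin k × Fin n) (Fin k × Fin n) ℂ}
    (hG : IsGamble G) : ofBlocks (block G) = G := by
  ext ⟨i, a⟩ ⟨j, b⟩
  by_cases h : i = j
  · subst h; simp [ofBlocks_apply, block]
  · simp [ofBlocks_apply, h, hG.2 i j a b h]

theorem ofBlocks_injective :
    Function.Injective (ofBlocks : (Fin k → Matrix (Fin n) (Fin n) ℂ) → _) := by
  intro A B h
  funext i
  rw [← block_ofBlocks A, h, block_ofBlocks]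

theorem ofBlocks_add (A B : Fin k → Matrix (Fin n) (Fin n) ℂ) :
    ofBlocks (A + B) = ofBlocks A + ofBlocks B := by
  ext x y
  by_cases h : x.1 = y.1 <;> simp [ofBlocks_apply, h]

theorem ofBlocks_smul (c : ℝ) (A : Fin k → Matrix (Fin n) (Fin n) ℂ) :
    ofBlocks (c • A) = c • ofBlocks A := by
  ext x y
  by_cases h : x.1 = y.1 <;> simp [ofBlocks_apply, h]

theorem ofBlocks_one : ofBlocks (1 : Fin k → Matrix (Fin n) (Fin n) ℂ) = 1 := by
  ext ⟨i, a⟩ ⟨j, b⟩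
  by_cases h : i = j <;> simp [ofBlocks_apply, h, Matrix.one_apply]

theorem diagC_kronecker (g : Fin k → ℝ) (E : Matrix (Fin n) (Fin n) ℂ) :
    diagC g ⊗ₖ E = ofBlocks fun i => g i • E := by
  ext ⟨i, a⟩ ⟨j, b⟩
  by_cases h : i = j
  · subst h; simp [ofBlocks_apply, diagC]
  · simp [ofBlocks_apply, diagC, h]

theorem compress_ofBlocks (E : Matrix (Fin n) (Fin n) ℂ)
    (A : Fin k → Matrix (Fin n) (Fin n) ℂ) :
    compress E (ofBlocks A) = ofBlocks fun i => E * A i * E := by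
  ext ⟨i, a⟩ ⟨j, b⟩
  by_cases h : i = j
  · subst h
    simp [compress, ofBlocks_apply, Matrix.mul_apply, Fintype.sum_prod_type, Matrix.one_apply]
  · simp [compress, ofBlocks_apply, Matrix.mul_apply, Fintype.sum_prod_type, Matrix.one_apply,
      h]

theorem trace_ofBlocks (A : Fin k → Matrix (Fin n) (Fin n) ℂ) :
    (ofBlocks A).trace = ∑ i, (A i).trace := by
  simp [Matrix.trace, ofBlocks_apply, Fintype.sum_prod_type]

theorem ofBlocks_mul (A B : Fin k → Matrix (Fin n) (Fin n) ℂ) :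
    ofBlocks A * ofBlocks B = ofBlocks fun i => A i * B i := by
  ext ⟨i, a⟩ ⟨j, b⟩
  by_cases h : i = j
  · subst h
    simp [ofBlocks_apply, Matrix.mul_apply, Fintype.sum_prod_type]
  · simp [ofBlocks_apply, Matrix.mul_apply, Fintype.sum_prod_type, h]

theorem conjTranspose_ofBlocks (A : Fin k → Matrix (Fin n) (Fin n) ℂ) :
    (ofBlocks A)ᴴ = ofBlocks fun i => (A i)ᴴ := by
  ext ⟨i, a⟩ ⟨j, b⟩
  by_cases h : i = j
  · subst h; simp [ofBlocks_apply]
  · simp [ofBlocks_apply, h, Ne.symm h]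

theorem isGamble_ofBlocks {A : Fin k → Matrix (Fin n) (Fin n) ℂ} (hA : ∀ i, (A i).IsHermitian) :
    IsGamble (ofBlocks A) := by
  refine ⟨?_, fun i j a b hij => by simp [ofBlocks_apply, hij]⟩
  rw [Matrix.IsHermitian, conjTranspose_ofBlocks]
  congr 1
  funext i
  exact hA i

theorem IsGamble.isHermitian_block {G : Matrix (Fin k × Fin n) (Fin k × Fin n) ℂ}
    (hG : IsGamble G) (i : Fin k) : (block G i).IsHermitian :=
  hG.1.submatrix (Prod.mk i)

theorem block_posSemidef {G : Matrix (Fin k × Fin n) (Fin k × Fin n) ℂ} (hG : G.PosSemidef)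
    (i : Fin k) : (block G i).PosSemidef :=
  hG.submatrix (Prod.mk i)

theorem ofBlocks_posSemidef {A : Fin k → Matrix (Fin n) (Fin n) ℂ}
    (hA : ∀ i, (A i).PosSemidef) : (ofBlocks A).PosSemidef := by
  refine .of_dotProduct_mulVec_nonneg (isGamble_ofBlocks fun i => (hA i).1).1 fun x => ?_
  have : star x ⬝ᵥ (ofBlocks A *ᵥ x) =
      ∑ i, star (fun a => x (i, a)) ⬝ᵥ (A i *ᵥ fun a => x (i, a)) := by
    simp [dotProduct, Matrix.mulVec, Fintype.sum_prod_type, ofBlocks_apply, ite_mul]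
  rw [this]
  exact Finset.sum_nonneg fun i _ => (hA i).dotProduct_mulVec_nonneg _

theorem IsGamble.add {G H : Matrix (Fin k × Fin n) (Fin k × Fin n) ℂ} (hG : IsGamble G)
    (hH : IsGamble H) : IsGamble (G + H) :=
  ⟨hG.1.add hH.1, fun i j a b hij => by simp [hG.2 i j a b hij, hH.2 i j a b hij]⟩

theorem IsGamble.sub {G H : Matrix (Fin k × Fin n) (Fin k × Fin n) ℂ} (hG : IsGamble G)
    (hH : IsGamble H) : IsGamble (G - H) :=
  ⟨hG.1.sub hH.1, fun i j a b hij => by simp [hG.2 i j a b hij, hH.2 i j a b hij]⟩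

theorem IsGamble.smul {G : Matrix (Fin k × Fin n) (Fin k × Fin n) ℂ} (hG : IsGamble G) (c : ℝ) :
    IsGamble (c • G) :=
  ⟨hG.1.real_smul c, fun i j a b hij => by simp [hG.2 i j a b hij]⟩

theorem isGamble_one : IsGamble (1 : Matrix (Fin k × Fin n) (Fin k × Fin n) ℂ) :=
  ⟨Matrix.isHermitian_one, fun i j a b hij => by simp [hij]⟩

end Blocks

/-! ### Lotteries as positive operator-valued measures -/

section Lotteries

variable {k n : ℕ}

/-- In a measurement containing E = vv*, compression turns a block B into (v*Bv) E; comparing traces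
identifies v*Bv with the pmf's value. -/
theorem IsQHLottery.pmf_of_unit {m : ℕ} {Q : Matrix (Fin m × Fin n) (Fin m × Fin n) ℂ}
    (hQ : IsQHLottery Q) {v : Fin n → ℂ} (hv : star v ⬝ᵥ v = 1) :
    ∃ p ∈ stdSimplex ℝ (Fin m), ∀ i, star v ⬝ᵥ (block Q i *ᵥ v) = p i := by
  obtain ⟨E, j, hE, hj⟩ := exists_isMeasurement hv
  obtain ⟨p, hp, h⟩ := hQ.2 E hE j
  refine ⟨p, hp, fun i => ?_⟩
  rw [← hQ.1.ofBlocks_block, compress_ofBlocks, diagC_kronecker] at h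
  have h1 := congrFun (ofBlocks_injective h) i
  rw [mul_mul_eq_trace_smul_of_rank_eq_one (hE.rank_one j)] at h1
  have h2 := congrArg Matrix.trace h1
  rw [Matrix.trace_smul, Matrix.trace_smul,
    trace_eq_one_of_idem_of_rank_eq_one (hE.rank_one j) (hE.idem j), hj,
    trace_vecMulVec_star_mul] at h2
  simpa using h2

/-- Together with `QL.sum_block` and the converse `isQHLottery_ofBlocks`, this identifies lotteries
with families of positive semidefinite blocks summing to the identity. -/
theorem QL.block_posSemidef (P : QL k n) (i : Fin (k + 1)) : (block P.1 i).PosSemidef := by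
  refine .of_dotProduct_mulVec_nonneg (P.2.1.isHermitian_block i) fun v => ?_
  by_cases hv : v = 0
  · simp [hv]
  obtain ⟨c, u, hu, rfl⟩ := exists_unit_smul hv
  obtain ⟨p, hp, h⟩ := P.2.pmf_of_unit hu
  rw [star_dotProduct_mulVec_smul, h]
  exact mul_nonneg (star_mul_self_nonneg c) (Complex.zero_le_real.mpr (hp.1 i))

theorem QL.sum_block (P : QL k n) : ∑ i, block P.1 i = 1 := by
  apply eq_of_unit_star_dotProduct
  intro u hu
  obtain ⟨p, hp, h⟩ := P.2.pmf_of_unit hu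
  rw [Matrix.sum_mulVec, dotProduct_sum, Matrix.one_mulVec, hu]
  simp only [h]
  exact_mod_cast hp.2

theorem isQHLottery_ofBlocks {m : ℕ} {A : Fin m → Matrix (Fin n) (Fin n) ℂ}
    (hA : ∀ i, (A i).PosSemidef) (hs : ∑ i, A i = 1) : IsQHLottery (ofBlocks A) := by
  refine ⟨isGamble_ofBlocks fun i => (hA i).1, fun E hE j => ?_⟩
  have hnn (i : Fin m) := (hE.posSemidef j).trace_mul_nonneg (hA i)
  refine ⟨fun i => (E j * A i).trace.re, ⟨fun i => (Complex.nonneg_iff.mp (hnn i)).1, ?_⟩, ?_⟩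
  · rw [← Complex.re_sum, ← Matrix.trace_sum, ← Finset.mul_sum, hs, mul_one,
      trace_eq_one_of_idem_of_rank_eq_one (hE.rank_one j) (hE.idem j), Complex.one_re]
  · rw [compress_ofBlocks, diagC_kronecker]
    congr 1
    funext i
    rw [mul_mul_eq_trace_smul_of_rank_eq_one (hE.rank_one j), ← Complex.coe_smul,
      ← Complex.eq_re_of_ofReal_le (r := 0) (by simpa using hnn i)]

theorem proj_ofBlocks (A : Fin (k + 1) → Matrix (Fin n) (Fin n) ℂ) :
    proj (ofBlocks A) = ofBlocks fun i => A i.castSucc := by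
  ext ⟨i, a⟩ ⟨j, b⟩
  simp [proj, ofBlocks_apply]

theorem QL.proj_eq (P : QL k n) : proj P.1 = ofBlocks fun i => block P.1 i.castSucc := by
  rw [← proj_ofBlocks, P.2.1.ofBlocks_block]

theorem proj_sub (G H : Matrix (Fin (k + 1) × Fin n) (Fin (k + 1) × Fin n) ℂ) :
    proj (G - H) = proj G - proj H := rfl

theorem QL.isGamble_proj (P : QL k n) : IsGamble (proj P.1) := by
  rw [P.proj_eq]
  exact isGamble_ofBlocks fun i => P.2.1.isHermitian_block _

theorem QL.proj_posSemidef (P : QL k n) : (proj P.1).PosSemidef := by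
  rw [P.proj_eq]
  exact ofBlocks_posSemidef fun i => P.block_posSemidef _

/-- The dropped block is recovered as 1 minus the sum of the others. -/
theorem QL.proj_injective : Function.Injective fun P : QL k n => proj P.1 := by
  intro P Q h
  apply Subtype.ext
  rw [← P.2.1.ofBlocks_block, ← Q.2.1.ofBlocks_block]
  congr 1
  have h1 : ∀ i : Fin k, block P.1 i.castSucc = block Q.1 i.castSucc := by
    simp only [QL.proj_eq] at h
    exact congrFun (ofBlocks_injective h)
  funext i
  refine Fin.lastCases ?_ h1 i
  have h2 := P.sum_block.trans Q.sum_block.symm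
  rw [Fin.sum_univ_castSucc, Fin.sum_univ_castSucc, Finset.sum_congr rfl fun i _ => h1 i] at h2
  exact add_left_cancel h2

theorem exists_lottery {A : Fin k → Matrix (Fin n) (Fin n) ℂ} (hA : ∀ i, (A i).PosSemidef)
    (hs : (1 - ∑ i, A i).PosSemidef) : ∃ P : QL k n, proj P.1 = ofBlocks A := by
  refine ⟨⟨ofBlocks (Fin.snoc A (1 - ∑ i, A i) : Fin (k + 1) → Matrix (Fin n) (Fin n) ℂ),
    isQHLottery_ofBlocks (fun i => ?_) ?_⟩, ?_⟩
  · refine Fin.lastCases ?_ (fun i => ?_) i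
    · simpa using hs
    · simpa using hA i
  · simp [Fin.sum_univ_castSucc]
  · rw [proj_ofBlocks]
    simp

theorem proj_Z : proj (Z k n).1 = 0 := by
  ext ⟨i, a⟩ ⟨j, b⟩
  by_cases h : i = j
  · subst h
    simp [proj, Z, diagC, (Fin.castSucc_lt_last i).ne]
  · simp [proj, Z, diagC, h]

theorem proj_mix (α : unitInterval) (P Q : QL k n) :
    proj (mix α P Q).1 = (α : ℝ) • proj P.1 + (1 - (α : ℝ)) • proj Q.1 := rfl

/-- Bounded positive gambles are projections of lotteries, up to scaling by the number of prizes. -/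
theorem exists_lottery_of_bounds (hk : 1 ≤ k) {G : Matrix (Fin k × Fin n) (Fin k × Fin n) ℂ}
    (hG : IsGamble G) (h0 : G.PosSemidef) (h1 : (1 - G).PosSemidef) :
    ∃ P : QL k n, proj P.1 = (k : ℝ)⁻¹ • G := by
  have hk0 : (k : ℝ) ≠ 0 := by positivity
  -- Each block is at most 1, so their sum is at most k; dividing by k leaves a nonnegative
  -- remainder for z.
  obtain ⟨P, hP⟩ := exists_lottery (A := fun i => (k : ℝ)⁻¹ • block G i)
    (fun i => (block_posSemidef h0 i).real_smul (by positivity)) (by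
      have h : (1 : Matrix (Fin n) (Fin n) ℂ) - ∑ i, (k : ℝ)⁻¹ • block G i =
          ∑ i : Fin k, (k : ℝ)⁻¹ • block (1 - G) i := by
        have hb (i : Fin k) : block (1 - G) i = 1 - block G i := by
          ext a b
          simp [block, Matrix.one_apply]
        simp only [hb, smul_sub, Finset.sum_sub_distrib]
        rw [Finset.sum_const, Finset.card_univ, Fintype.card_fin, ← Nat.cast_smul_eq_nsmul ℝ,
          smul_smul, mul_inv_cancel₀ hk0, one_smul]
      rw [h]
      exact Matrix.posSemidef_sum _ fun i _ =>
        (block_posSemidef h1 i).real_smul (by positivity))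
  refine ⟨P, hP.trans ?_⟩
  rw [show (fun i => (k : ℝ)⁻¹ • block G i) = (k : ℝ)⁻¹ • block G from rfl, ofBlocks_smul,
    hG.ofBlocks_block]

end Lotteries

/-! ### The cone of desirable gambles -/

section Desirable

variable {k n : ℕ} {succ : QL k n → QL k n → Prop}

theorem PSDNZ.smul {ι : Type*} [Fintype ι] {G : Matrix ι ι ℂ} (hG : PSDNZ G) {c : ℝ}
    (hc : 0 < c) : PSDNZ (c • G) :=
  ⟨hG.1.real_smul hc.le, smul_ne_zero hc.ne' hG.2⟩

theorem psdnz_smul_iff {ι : Type*} [Fintype ι] {G : Matrix ι ι ℂ} {c : ℝ}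
    (hc : 0 < c) : PSDNZ (c • G) ↔ PSDNZ G := by
  refine ⟨fun h => ?_, fun h => h.smul hc⟩
  have := h.smul (inv_pos.mpr hc)
  rwa [smul_smul, inv_mul_cancel₀ hc.ne', one_smul] at this

theorem PSDNZ.add {ι : Type*} [Fintype ι] {G H : Matrix ι ι ℂ} (hG : PSDNZ G) (hH : PSDNZ H) :
    PSDNZ (G + H) := by
  refine ⟨hG.1.add hH.1, fun h => hG.2 (eq_zero_of_posSemidef_of_neg hG.1 ?_)⟩
  rw [neg_eq_of_add_eq_zero_right h]
  exact hH.1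

theorem psdnz_one (hk : 1 ≤ k) (hn : 1 ≤ n) :
    PSDNZ (1 : Matrix (Fin k × Fin n) (Fin k × Fin n) ℂ) := by
  have : Nonempty (Fin k × Fin n) := ⟨⟨⟨0, hk⟩, ⟨0, hn⟩⟩⟩
  exact ⟨.one, one_ne_zero⟩

theorem isGamble_of_mem_desirable {G : Matrix (Fin k × Fin n) (Fin k × Fin n) ℂ}
    (hG : G ∈ desirable succ) : IsGamble G := by
  obtain ⟨c, P, Q, -, -, rfl⟩ := hG
  exact (P.isGamble_proj.sub Q.isGamble_proj).smul c

theorem smul_mem_desirable {G : Matrix (Fin k × Fin n) (Fin k × Fin n) ℂ}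
    (hG : G ∈ desirable succ) {c : ℝ} (hc : 0 < c) : c • G ∈ desirable succ := by
  obtain ⟨d, P, Q, hd, hs, rfl⟩ := hG
  exact ⟨c * d, P, Q, mul_pos hc hd, hs, smul_smul _ _ _⟩

theorem IsCoherent.zero_notMem_desirable (h : IsCoherent succ) : 0 ∉ desirable succ := by
  rintro ⟨c, P, Q, hc, hs, h0⟩
  have h1 : proj P.1 - proj Q.1 = 0 := (smul_eq_zero.mp h0.symm).resolve_left hc.ne'
  obtain rfl := QL.proj_injective (sub_eq_zero.mp h1)
  exact h.irrefl _ hs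

/-- With α = c/(c+d) and β = d/(c+d), mixing both preferences gives αP + βP' ≻ αQ + βP' ≻ αQ + βQ'.
The outer difference, scaled by c+d, is the required sum. -/
theorem IsCoherent.add_mem_desirable (h : IsCoherent succ)
    {G H : Matrix (Fin k × Fin n) (Fin k × Fin n) ℂ} (hG : G ∈ desirable succ)
    (hH : H ∈ desirable succ) : G + H ∈ desirable succ := by
  obtain ⟨c, P, Q, hc, hs, rfl⟩ := hG
  obtain ⟨d, P', Q', hd, hs', rfl⟩ := hH
  have hcd : 0 < c + d := by positivity
  let α : unitInterval := ⟨c / (c + d), by positivity, by rw [div_le_one hcd]; linarith⟩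
  let β : unitInterval := ⟨d / (c + d), by positivity, by rw [div_le_one hcd]; linarith⟩
  have hα : (0 : unitInterval) < α := Subtype.mk_lt_mk.mpr (by positivity)
  have hβ : (0 : unitInterval) < β := Subtype.mk_lt_mk.mpr (by positivity)
  have hαβ : (1 : ℝ) - c / (c + d) = d / (c + d) := by field_simp; ring
  have hβα : (1 : ℝ) - d / (c + d) = c / (c + d) := by field_simp; ring
  have h1 := (h.mixture P Q P' α hα).mp hs
  have h2 := (h.mixture P' Q' Q β hβ).mp hs'
  have e : mix α Q P' = mix β P' Q := by
    apply QL.proj_injective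
    simp only [proj_mix, α, β, hαβ, hβα]
    abel
  rw [e] at h1
  refine ⟨c + d, _, _, hcd, h.trans _ _ _ h1 h2, ?_⟩
  simp only [proj_sub, proj_mix, α, β, hαβ, hβα, smul_add, smul_sub, smul_smul,
    mul_div_cancel₀ _ hcd.ne']
  abel

/-- If P - Q = c(P' - Q') after projection, put α = 1/(1+c) and β = c/(1+c). Then βQ' + αP = αQ +
βP', so mixing P' ≻ Q' with P gives αP + βP' ≻ αQ + βP', and independence cancels P'. -/
theorem IsCoherent.succ_iff_mem_desirable (h : IsCoherent succ) (P Q : QL k n) :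
    succ P Q ↔ proj P.1 - proj Q.1 ∈ desirable succ := by
  refine ⟨fun hs => ⟨1, P, Q, one_pos, hs, (one_smul _ _).symm⟩, ?_⟩
  rintro ⟨c, P', Q', hc, hs, he⟩
  have hc1 : 0 < 1 + c := by positivity
  let α : unitInterval := ⟨1 / (1 + c), by positivity, by rw [div_le_one hc1]; linarith⟩
  let β : unitInterval := ⟨c / (1 + c), by positivity, by rw [div_le_one hc1]; linarith⟩
  have hα : (0 : unitInterval) < α := Subtype.mk_lt_mk.mpr (by positivity)
  have hβ : (0 : unitInterval) < β := Subtype.mk_lt_mk.mpr (by positivity)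
  have hαβ : (1 : ℝ) - 1 / (1 + c) = c / (1 + c) := by field_simp; ring
  have hβα : (1 : ℝ) - c / (1 + c) = 1 / (1 + c) := by field_simp; ring
  have hc2 : c / (1 + c) = 1 / (1 + c) * c := by field_simp
  have h1 := (h.mixture P' Q' P β hβ).mp hs
  have e1 : mix β P' P = mix α P P' := by
    apply QL.proj_injective
    simp only [proj_mix, α, β, hαβ, hβα]
    abel
  have e2 : mix β Q' P = mix α Q P' := by
    apply QL.proj_injective
    simp only [proj_mix, α, β, hαβ, hβα]
    rw [sub_eq_iff_eq_add.mp he, hc2, proj_sub]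
    module
  rw [e1, e2] at h1
  exact (h.mixture P Q P' α hα).mpr h1

/-- Scaled down, G is the projection of a lottery other than Z, while Z projects to 0. -/
theorem HasWorst.mem_desirable_of_psdnz (h : HasWorst succ) (hk : 1 ≤ k)
    {G : Matrix (Fin k × Fin n) (Fin k × Fin n) ℂ} (hG : IsGamble G) (h0 : PSDNZ G) :
    G ∈ desirable succ := by
  obtain ⟨t, ht, h1⟩ := exists_smul_one_sub_posSemidef hG.1
  have hk0 : (0 : ℝ) < k := by positivity
  obtain ⟨P, hP⟩ := exists_lottery_of_bounds hk (hG.smul t⁻¹) (h0.1.real_smul (by positivity)) (by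
    have := h1.real_smul (inv_pos.mpr ht).le
    rwa [smul_sub, smul_smul, inv_mul_cancel₀ ht.ne', one_smul] at this)
  have e : G = (k * t : ℝ) • proj P.1 := by
    rw [hP, smul_smul, smul_smul]
    field_simp
    rw [one_smul]
  refine ⟨k * t, P, Z k n, by positivity, h P ?_, ?_⟩
  · rintro rfl
    rw [proj_Z, smul_zero] at e
    exact h0.2 e
  · rw [proj_sub, proj_Z, sub_zero, ← e]

/-- A reference lottery in the interior: half of its mass stays on z, leaving room for perturbations
of either sign. -/
theorem exists_lottery_uniform (hk : 1 ≤ k) :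
    ∃ U : QL k n, proj U.1 = (k : ℝ)⁻¹ • (1 / 2 : ℝ) • 1 := by
  refine exists_lottery_of_bounds hk (isGamble_one.smul _) (Matrix.PosSemidef.one.real_smul
    (by norm_num)) ?_
  have e : (1 : Matrix (Fin k × Fin n) (Fin k × Fin n) ℂ) - (1 / 2 : ℝ) • 1 = (1 / 2 : ℝ) • 1 := by
    module
  rw [e]
  exact Matrix.PosSemidef.one.real_smul (by norm_num)

/-- For t•1 ± G ≥ 0, the gamble (t•1 + G)/(2t) lies between 0 and 1 and differs from the constant
1/2 by G/(2t). -/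
theorem exists_eq_smul_proj_sub (hk : 1 ≤ k) {G : Matrix (Fin k × Fin n) (Fin k × Fin n) ℂ}
    (hG : IsGamble G) :
    ∃ (c : ℝ) (P Q : QL k n), 0 < c ∧ G = c • (proj P.1 - proj Q.1) := by
  obtain ⟨t, ht, h1, h2⟩ := exists_smul_one_sub_add_posSemidef hG.1
  have hk0 : (0 : ℝ) < k := by positivity
  obtain ⟨U, hU⟩ := exists_lottery_uniform (n := n) hk
  obtain ⟨P, hP⟩ := exists_lottery_of_bounds hk
    (G := (1 / (2 * t) : ℝ) • (t • (1 : Matrix (Fin k × Fin n) (Fin k × Fin n) ℂ) + G))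
    (((isGamble_one.smul t).add hG).smul _)
    (h2.real_smul (by positivity)) (by
      convert h1.real_smul (c := 1 / (2 * t)) (by positivity) using 1
      rw [smul_add, smul_sub, smul_smul, show 1 / (2 * t) * t = 1 / 2 by field_simp]
      module)
  refine ⟨2 * k * t, P, U, by positivity, ?_⟩
  rw [hP, hU, ← smul_sub, smul_add, smul_smul _ t, show 1 / (2 * t) * t = 1 / 2 by field_simp,
    add_sub_cancel_left, smul_smul, smul_smul]
  field_simp
  rw [one_smul]

namespace IsWACoherent

variable (h : IsWACoherent succ)
include h

theorem add_posSemidef_mem_desirable (hk : 1 ≤ k)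
    {G H : Matrix (Fin k × Fin n) (Fin k × Fin n) ℂ} (hG : G ∈ desirable succ)
    (hH : IsGamble H) (hH0 : H.PosSemidef) : G + H ∈ desirable succ := by
  by_cases h0 : H = 0
  · rwa [h0, add_zero]
  · exact h.coherent.add_mem_desirable hG (h.worst.mem_desirable_of_psdnz hk hH ⟨hH0, h0⟩)

/-- Strict desirability of the gambles that are not positive. -/
theorem exists_sub_smul_one_mem (hk : 1 ≤ k)
    {G : Matrix (Fin k × Fin n) (Fin k × Fin n) ℂ} (hG : G ∈ desirable succ) (hG0 : ¬ PSDNZ G) :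
    ∃ ε : ℝ, 0 < ε ∧ G - ε • (1 : Matrix (Fin k × Fin n) (Fin k × Fin n) ℂ) ∈ desirable succ := by
  obtain ⟨c, P, Q, hc, hs, rfl⟩ := hG
  obtain ⟨U, hU⟩ := exists_lottery_uniform (n := n) hk
  have hk0 : (0 : ℝ) < k := by positivity
  -- Mixing with U first ensures that the move towards Z given by Archimedeanity costs a positive
  -- multiple of the identity.
  let β : unitInterval := ⟨1 / 2, by norm_num, by norm_num⟩
  have hβ : (0 : unitInterval) < β := Subtype.mk_lt_mk.mpr (by norm_num)
  have h1 := (h.coherent.mixture P Q U β hβ).mp hs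
  obtain ⟨α, hα0, hα1, h2⟩ := h.archimedean _ _ h1 (by
    intro ho
    apply hG0
    rw [psdnz_smul_iff hc]
    rw [ObjPref, proj_sub, proj_mix, proj_mix, add_sub_add_right_eq_sub, ← smul_sub,
      psdnz_smul_iff (show (0 : ℝ) < β from hβ)] at ho
    exact ho)
  rw [h.coherent.succ_iff_mem_desirable, proj_mix, proj_mix, proj_mix, proj_Z, smul_zero,
    add_zero, hU] at h2
  have hα : 0 < 1 - (α : ℝ) := sub_pos.mpr hα1
  have h3 := h.add_posSemidef_mem_desirable hk (smul_mem_desirable h2 (c := 2 * c) (by positivity))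
    (P.isGamble_proj.smul (c * (1 - α))) (P.proj_posSemidef.real_smul (by positivity))
  -- Adding back the lost c(1-α)P leaves c(P - Q) - c(1-α)U, and U projects to 1/(2k).
  refine ⟨c * (1 - α) * (k : ℝ)⁻¹ * (1 / 2), by positivity, ?_⟩
  convert h3 using 1
  simp only [β, proj_sub]
  module

end IsWACoherent

end Desirable

/-! ### Representing states: existence and uniqueness -/

section States

variable {k n : ℕ}

/-- The gamble part of a matrix: its Hermitian part with the off-diagonal blocks removed. -/
noncomputable def gamblePart : Matrix (Fin k × Fin n) (Fin k × Fin n) ℂ →ₗ[ℝ]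
    Matrix (Fin k × Fin n) (Fin k × Fin n) ℂ where
  toFun M := (1 / 2 : ℝ) • (ofBlocks (block M) + (ofBlocks (block M))ᴴ)
  map_add' M N := by
    rw [show block (M + N) = block M + block N from rfl, ofBlocks_add, Matrix.conjTranspose_add]
    module
  map_smul' c M := by
    rw [show block (c • M) = c • block M from rfl, ofBlocks_smul, Matrix.conjTranspose_smul]
    simp only [star_trivial, RingHom.id_apply]
    module

theorem gamblePart_apply (M : Matrix (Fin k × Fin n) (Fin k × Fin n) ℂ) :
    gamblePart M = (1 / 2 : ℝ) • (ofBlocks (block M) + (ofBlocks (block M))ᴴ) := rfl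

theorem IsGamble.gamblePart_eq {G : Matrix (Fin k × Fin n) (Fin k × Fin n) ℂ}
    (hG : IsGamble G) : gamblePart G = G := by
  rw [gamblePart_apply, hG.ofBlocks_block, hG.1.eq]
  module

theorem isGamble_gamblePart (M : Matrix (Fin k × Fin n) (Fin k × Fin n) ℂ) :
    IsGamble (gamblePart M) := by
  rw [gamblePart_apply, conjTranspose_ofBlocks, ← ofBlocks_add, ← ofBlocks_smul]
  refine isGamble_ofBlocks fun i => Matrix.IsHermitian.real_smul ?_ _
  exact Matrix.isHermitian_add_transpose_self _

theorem gamblePart_posSemidef {M : Matrix (Fin k × Fin n) (Fin k × Fin n) ℂ}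
    (hM : M.PosSemidef) : (gamblePart M).PosSemidef := by
  have h : (ofBlocks (block M)).PosSemidef := ofBlocks_posSemidef (block_posSemidef hM)
  exact (h.add h.conjTranspose).real_smul (by norm_num)

theorem gamblePart_eq_zero_of_block_eq_zero {M : Matrix (Fin k × Fin n) (Fin k × Fin n) ℂ}
    (hM : block M = 0) : gamblePart M = 0 := by
  have : ofBlocks (0 : Fin k → Matrix (Fin n) (Fin n) ℂ) = 0 := by
    ext x y; simp [ofBlocks_apply]
  rw [gamblePart_apply, hM, this]
  simp

theorem gamblePart_conjTranspose (M : Matrix (Fin k × Fin n) (Fin k × Fin n) ℂ) :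
    gamblePart Mᴴ = gamblePart M := by
  have : ofBlocks (block Mᴴ) = (ofBlocks (block M))ᴴ := by
    rw [conjTranspose_ofBlocks]; rfl
  rw [gamblePart_apply, gamblePart_apply, this, Matrix.conjTranspose_conjTranspose, add_comm]

/-- The expectation functional of a matrix. -/
noncomputable def expect {ι : Type*} [Fintype ι] (R : Matrix ι ι ℂ) : Matrix ι ι ℂ →ₗ[ℝ] ℝ where
  toFun G := (G * R).trace.re
  map_add' G H := by rw [add_mul, Matrix.trace_add, Complex.add_re]
  map_smul' c G := by simp [Matrix.trace_smul]

theorem expect_apply {ι : Type*} [Fintype ι] (R G : Matrix ι ι ℂ) :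
    expect R G = (G * R).trace.re := rfl

/-- Every real-linear functional on complex matrices is an expectation functional. -/
theorem exists_eq_expect {ι : Type*} [Fintype ι] [DecidableEq ι] (f : Matrix ι ι ℂ →ₗ[ℝ] ℝ) :
    ∃ R : Matrix ι ι ℂ, expect R = f ∧ ∀ x y, R x y =
      ⟨f (Matrix.single y x 1), -f (Matrix.single y x Complex.I)⟩ := by
  -- With E_yx the matrix unit, Re Tr(z E_yx R) = Re(z R_xy), so z = 1 and z = i read off the entry.
  refine ⟨Matrix.of fun x y => ⟨f (Matrix.single y x 1), -f (Matrix.single y x Complex.I)⟩,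
    ?_, fun _ _ => rfl⟩
  ext M
  rw [expect_apply]
  conv_rhs => rw [Matrix.matrix_eq_sum_single M]
  simp only [map_sum, Matrix.trace, Matrix.diag_apply, Matrix.mul_apply, Matrix.of_apply,
    Complex.re_sum]
  refine Finset.sum_congr rfl fun x _ => Finset.sum_congr rfl fun y _ => ?_
  have h : Matrix.single x y (M x y) = (M x y).re • Matrix.single x y (1 : ℂ) +
      (M x y).im • Matrix.single x y Complex.I := by
    rw [Matrix.smul_single, Matrix.smul_single, ← Matrix.single_add]
    congr 1
    simp
  rw [h, map_add, map_smul, map_smul]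
  simp

/-- The cone for the Riesz extension lives on all complex matrices and contains the kernel of
`gamblePart`, which forces the functional to factor through gambles. Multiples of 1 dominate every
Hermitian matrix, which supplies the cofinality condition. -/
theorem exists_functional (hk : 1 ≤ k) (hn : 1 ≤ n) {succ : QL k n → QL k n → Prop}
    (h : IsWACoherent succ) :
    ∃ f : Matrix (Fin k × Fin n) (Fin k × Fin n) ℂ →ₗ[ℝ] ℝ, f 1 = 1 ∧
      (∀ M, f (gamblePart M) = f M) ∧ ∀ G ∈ desirable succ, 0 ≤ f G := by
  have h1 := psdnz_one hk hn
  let s : PointedCone ℝ (Matrix (Fin k × Fin n) (Fin k × Fin n) ℂ) :=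
    { carrier := {M | gamblePart M = 0 ∨ gamblePart M ∈ desirable succ}
      add_mem' := by
        rintro M N (hM | hM) (hN | hN)
        · left; rw [map_add, hM, hN, add_zero]
        · right; rwa [map_add, hM, zero_add]
        · right; rwa [map_add, hN, add_zero]
        · right; rw [map_add]; exact h.coherent.add_mem_desirable hM hN
      zero_mem' := Or.inl (map_zero _)
      smul_mem' := by
        rintro ⟨c, hc⟩ M hM
        change gamblePart (c • M) = 0 ∨ gamblePart (c • M) ∈ desirable succ
        rw [map_smul]
        rcases hc.eq_or_lt with rfl | hc
        · left; rw [zero_smul]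
        · rcases hM with hM | hM
          · left; rw [hM, smul_zero]
          · right; exact smul_mem_desirable hM hc }
  have hs (M) : M ∈ s ↔ gamblePart M = 0 ∨ gamblePart M ∈ desirable succ := Iff.rfl
  have hl (t : ℝ) (ht) : LinearPMap.mkSpanSingleton (σ := RingHom.id ℝ)
      (1 : Matrix (Fin k × Fin n) (Fin k × Fin n) ℂ) (1 : ℝ) h1.2 ⟨t • 1, ht⟩ = t := by
    refine (LinearPMap.mkSpanSingleton'_apply (σ := RingHom.id ℝ) _ _ _ _ _).trans ?_
    exact mul_one t
  obtain ⟨f, hf1, hf⟩ := riesz_extension s (LinearPMap.mkSpanSingleton 1 (1 : ℝ) h1.2) (by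
    rintro ⟨x, hx⟩ hxs
    obtain ⟨t, rfl⟩ := Submodule.mem_span_singleton.mp hx
    rw [hl]
    rw [hs, map_smul, isGamble_one.gamblePart_eq] at hxs
    rcases hxs with h0 | h0
    · exact ((smul_eq_zero.mp h0).resolve_right h1.2).ge
    -- For t < 0 both t•1 and -t•1 would be desirable, hence so would 0.
    · by_contra! ht
      have := h.coherent.add_mem_desirable h0 (h.worst.mem_desirable_of_psdnz hk
        (isGamble_one.smul (-t)) (h1.smul (neg_pos.mpr ht)))
      rw [← add_smul, add_neg_cancel, zero_smul] at this
      exact h.coherent.zero_notMem_desirable this) (by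
    intro M
    obtain ⟨t, ht, -, h2⟩ := exists_smul_one_sub_add_posSemidef (isGamble_gamblePart M).1
    refine ⟨⟨t • 1, Submodule.smul_mem _ _ (Submodule.mem_span_singleton_self _)⟩, ?_⟩
    rw [hs, map_add, map_smul, isGamble_one.gamblePart_eq]
    by_cases h0 : t • 1 + gamblePart M = 0
    · exact Or.inl h0
    · exact Or.inr (h.worst.mem_desirable_of_psdnz hk
        ((isGamble_one.smul t).add (isGamble_gamblePart M)) ⟨h2, h0⟩))
  refine ⟨f, ?_, fun M => ?_, fun G hG => hf G ?_⟩
  · have h2 := (hf1 ⟨(1 : ℝ) • 1, Submodule.mem_span_singleton.mpr ⟨1, rfl⟩⟩).trans (hl 1 _)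
    simpa only [one_smul] using h2
  -- The difference and its negative both lie in the cone, so f vanishes on it.
  · have h0 : gamblePart (gamblePart M - M) = 0 := by
      rw [map_sub, (isGamble_gamblePart M).gamblePart_eq, sub_self]
    have h2 := hf _ ((hs _).mpr (Or.inl h0))
    have h3 := hf (-(gamblePart M - M)) ((hs _).mpr (Or.inl (by rw [map_neg, h0, neg_zero])))
    rw [map_neg] at h3
    rw [map_sub] at h2 h3
    linarith
  · rw [hs, (isGamble_of_mem_desirable hG).gamblePart_eq]
    exact Or.inr hG

/-- Since f factors through `gamblePart`, it ignores adjoints and off-diagonal blocks, so R is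
Hermitian and block-diagonal. Testing on vv* gives positivity. -/
theorem exists_state (hk : 1 ≤ k) (hn : 1 ≤ n) {succ : QL k n → QL k n → Prop}
    (h : IsWACoherent succ) :
    ∃ R : Matrix (Fin k × Fin n) (Fin k × Fin n) ℂ, IsState R ∧
      ∀ G ∈ desirable succ, 0 ≤ expect R G := by
  obtain ⟨f, hf1, hfg, hf⟩ := exists_functional hk hn h
  obtain ⟨R, rfl, hR⟩ := exists_eq_expect f
  have hherm : R.IsHermitian := by
    ext x y
    rw [Matrix.conjTranspose_apply, hR, hR, ← hfg (Matrix.single y x 1),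
      ← hfg (Matrix.single y x Complex.I), ← gamblePart_conjTranspose,
      ← gamblePart_conjTranspose (Matrix.single y x Complex.I), hfg, hfg,
      Matrix.conjTranspose_single, Matrix.conjTranspose_single]
    have : Matrix.single x y (star Complex.I) = -Matrix.single x y Complex.I := by
      rw [Matrix.single_neg]; simp
    rw [this, map_neg, star_one]
    apply Complex.ext <;> simp
  have hgamble : IsGamble R := by
    refine ⟨hherm, fun i j a b hij => ?_⟩
    have h0 (z : ℂ) : expect R (Matrix.single (j, b) (i, a) z) = 0 := by
      rw [← hfg, gamblePart_eq_zero_of_block_eq_zero, map_zero]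
      funext l
      ext c d
      simp only [block, Matrix.of_apply, Matrix.single_apply, Prod.mk.injEq, Pi.zero_apply,
        Matrix.zero_apply, ite_eq_right_iff]
      rintro ⟨⟨rfl, -⟩, rfl, -⟩
      exact absurd rfl hij
    rw [hR, h0, h0, neg_zero]
    rfl
  have hpsd : R.PosSemidef := by
    refine .of_dotProduct_mulVec_nonneg hherm fun v => ?_
    rw [Complex.nonneg_iff]
    refine ⟨?_, (hherm.im_star_dotProduct_mulVec_self v).symm⟩
    rw [← trace_vecMulVec_star_mul, ← expect_apply, ← hfg]
    have hv := gamblePart_posSemidef (k := k) (n := n) (Matrix.posSemidef_vecMulVec_self_star v)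
    by_cases h0 : gamblePart (Matrix.vecMulVec v (star v)) = 0
    · rw [h0, map_zero]
    · exact hf _ (h.worst.mem_desirable_of_psdnz hk (isGamble_gamblePart _) ⟨hv, h0⟩)
  refine ⟨R, ⟨hgamble, hpsd, ?_⟩, hf⟩
  rw [expect_apply, one_mul] at hf1
  exact Complex.ext hf1 (Complex.nonneg_iff.mp hpsd.trace_nonneg).2.symm

theorem IsState.expect_one {R : Matrix (Fin k × Fin n) (Fin k × Fin n) ℂ} (hR : IsState R) :
    expect R 1 = 1 := by
  rw [expect_apply, one_mul, hR.2.2, Complex.one_re]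

theorem IsState.expect_nonneg {R : Matrix (Fin k × Fin n) (Fin k × Fin n) ℂ} (hR : IsState R)
    {G : Matrix (Fin k × Fin n) (Fin k × Fin n) ℂ} (hG : G.PosSemidef) : 0 ≤ expect R G :=
  hG.trace_mul_re_nonneg hR.2.1

/-- The relation represented by a state. -/
def stateRel (R : Matrix (Fin k × Fin n) (Fin k × Fin n) ℂ) (P Q : QL k n) : Prop :=
  PSDNZ (proj P.1 - proj Q.1) ∨ 0 < expect R (proj P.1 - proj Q.1)

theorem isRepresentedBy_iff {succ : QL k n → QL k n → Prop}
    {R : Matrix (Fin k × Fin n) (Fin k × Fin n) ℂ} :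
    IsRepresentedBy succ R ↔ ∀ P Q, succ P Q ↔ stateRel R P Q := by
  unfold IsRepresentedBy stateRel
  simp only [map_sub, sub_pos, expect_apply, ObjPref, proj_sub, gt_iff_lt,
    fun P : QL k n => P.isGamble_proj.1.eq]

theorem isWACoherent_stateRel {R : Matrix (Fin k × Fin n) (Fin k × Fin n) ℂ} (hR : IsState R) :
    IsWACoherent (stateRel R) where
  coherent :=
    { irrefl := by
        rintro P (h | h)
        · exact h.2 (sub_self _)
        · rw [sub_self, map_zero] at h
          exact h.false
      trans := by
        intro P Q S h1 h2
        unfold stateRel at *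
        rw [← sub_add_sub_cancel _ (proj Q.1) _, map_add]
        rcases h1 with h1 | h1 <;> rcases h2 with h2 | h2
        · exact Or.inl (h1.add h2)
        · exact Or.inr (add_pos_of_nonneg_of_pos (hR.expect_nonneg h1.1) h2)
        · exact Or.inr (add_pos_of_pos_of_nonneg h1 (hR.expect_nonneg h2.1))
        · exact Or.inr (add_pos h1 h2)
      mixture := by
        intro P Q S α hα
        replace hα : (0 : ℝ) < α := hα
        unfold stateRel
        rw [proj_mix, proj_mix, add_sub_add_right_eq_sub, ← smul_sub, psdnz_smul_iff hα,
          map_smul, smul_eq_mul, mul_pos_iff_of_pos_left hα] }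
  worst := by
    intro P hP
    left
    rw [proj_Z, sub_zero]
    refine ⟨P.proj_posSemidef, fun h => hP (QL.proj_injective ?_)⟩
    exact h.trans proj_Z.symm
  archimedean := by
    intro P Q h hPQ
    replace h := h.resolve_left hPQ
    rw [map_sub, sub_pos] at h
    set p := expect R (proj P.1)
    set q := expect R (proj Q.1)
    have hq : 0 ≤ q := hR.expect_nonneg Q.proj_posSemidef
    have hp : 0 < p := hq.trans_lt h
    -- This weight moves the expectation p of P to the midpoint of p and q, still above q.
    have hα0 : 0 < (p + q) / (2 * p) := by positivity
    have hα1 : (p + q) / (2 * p) < 1 := by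
      rw [div_lt_one (by positivity)]; linarith
    refine ⟨⟨(p + q) / (2 * p), hα0.le, hα1.le⟩, hα0, hα1, Or.inr ?_⟩
    rw [proj_mix, proj_Z, smul_zero, add_zero, map_sub, map_smul, smul_eq_mul, sub_pos]
    change q < (p + q) / (2 * p) * p
    rw [show (p + q) / (2 * p) * p = (p + q) / 2 by field_simp]
    linarith

/-- A complete relation is represented by a state. -/
theorem exists_isRepresentedBy (hk : 1 ≤ k) (hn : 1 ≤ n) {succ : QL k n → QL k n → Prop}
    (h : IsCompleteWACoherent succ) :
    ∃ R : Matrix (Fin k × Fin n) (Fin k × Fin n) ℂ, IsState R ∧ IsRepresentedBy succ R := by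
  obtain ⟨R, hR, hpos⟩ := exists_state hk hn h.waCoherent
  have hle (P Q) (hPQ : succ P Q) : stateRel R P Q := by
    by_cases h0 : PSDNZ (proj P.1 - proj Q.1)
    · exact Or.inl h0
    rw [h.waCoherent.coherent.succ_iff_mem_desirable] at hPQ
    -- Nonnegativity at G - ε•1 and normalization give expectation at least ε > 0.
    obtain ⟨ε, hε, h1⟩ := h.waCoherent.exists_sub_smul_one_mem hk hPQ h0
    have h2 := hpos _ h1
    rw [map_sub, map_smul, hR.expect_one, smul_eq_mul, mul_one, sub_nonneg] at h2
    exact Or.inr (hε.trans_le h2)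
  refine ⟨R, hR, isRepresentedBy_iff.mpr fun P Q => ⟨hle P Q, ?_⟩⟩
  exact h.maximal _ (isWACoherent_stateRel hR) hle P Q

theorem IsRepresentedBy.mem_desirable_iff (hk : 1 ≤ k) {succ : QL k n → QL k n → Prop}
    {R : Matrix (Fin k × Fin n) (Fin k × Fin n) ℂ} (h : IsRepresentedBy succ R)
    {G : Matrix (Fin k × Fin n) (Fin k × Fin n) ℂ} (hG : IsGamble G) :
    G ∈ desirable succ ↔ PSDNZ G ∨ 0 < expect R G := by
  rw [isRepresentedBy_iff] at h
  constructor
  · rintro ⟨c, P, Q, hc, hs, rfl⟩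
    rw [h, stateRel, ← proj_sub] at hs
    rwa [psdnz_smul_iff hc, map_smul, smul_eq_mul, mul_pos_iff_of_pos_left hc]
  · obtain ⟨c, P, Q, hc, rfl⟩ := exists_eq_smul_proj_sub hk hG
    rw [psdnz_smul_iff hc, map_smul, smul_eq_mul, mul_pos_iff_of_pos_left hc]
    intro hs
    exact ⟨c, P, Q, hc, (h P Q).mpr hs, rfl⟩

/-- A linear functional that is nonnegative where another one is positive is a multiple of it,
in the presence of a normalizing element. -/
theorem eq_mul_of_forall_pos_imp_nonneg {V : Type*} [AddCommGroup V] [Module ℝ V]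
    {f g : V →ₗ[ℝ] ℝ} {S : Submodule ℝ V} {e : V} (he : e ∈ S) (hfe : f e = 1)
    (h : ∀ x ∈ S, 0 < f x → 0 ≤ g x) {x : V} (hx : x ∈ S) : g x = f x * g e := by
  -- A small multiple of e pushes y from the kernel of f to where f is positive. Applied to y and
  -- -y, this puts the kernel of f inside that of g.
  have key : ∀ y ∈ S, f y = 0 → 0 ≤ g y := by
    intro y hy hy0
    have hge : 0 ≤ g e := h e he (by rw [hfe]; exact one_pos)
    refine le_of_forall_pos_le_add fun ε hε => ?_
    -- The 1 guards against g e = 0.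
    have hd : 0 < ε / (g e + 1) := by positivity
    have h1 := h (y + (ε / (g e + 1)) • e) (S.add_mem hy (S.smul_mem _ he))
      (by rw [map_add, map_smul, hy0, hfe, smul_eq_mul, mul_one, zero_add]; exact hd)
    rw [map_add, map_smul, smul_eq_mul] at h1
    have h2 : ε / (g e + 1) * g e ≤ ε := by
      rw [div_mul_eq_mul_div, div_le_iff₀ (by positivity)]
      nlinarith
    linarith
  have hy : x - f x • e ∈ S := S.sub_mem hx (S.smul_mem _ he)
  have hy0 : f (x - f x • e) = 0 := by
    rw [map_sub, map_smul, hfe, smul_eq_mul, mul_one, sub_self]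
  have h1 := key _ hy hy0
  have h2 := key _ (S.neg_mem hy) (by rw [map_neg, hy0, neg_zero])
  rw [map_neg] at h2
  rw [map_sub, map_smul, smul_eq_mul] at h1 h2
  linarith

/-- The real vector space of gambles. -/
def gambleSubmodule (k n : ℕ) : Submodule ℝ (Matrix (Fin k × Fin n) (Fin k × Fin n) ℂ) where
  carrier := {G | IsGamble G}
  add_mem' := IsGamble.add
  zero_mem' := ⟨Matrix.isHermitian_zero, fun _ _ _ _ _ => rfl⟩
  smul_mem' c _ hG := hG.smul c

/-- Both expectations are normalized at 1, so proportionality makes them equal on gambles. Testing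
on R' - R shows that its Hilbert–Schmidt norm is 0. -/
theorem IsRepresentedBy.unique (hk : 1 ≤ k) {succ : QL k n → QL k n → Prop}
    {R R' : Matrix (Fin k × Fin n) (Fin k × Fin n) ℂ} (hR : IsState R) (hR' : IsState R')
    (h : IsRepresentedBy succ R) (h' : IsRepresentedBy succ R') : R' = R := by
  have hpos : ∀ G ∈ gambleSubmodule k n, 0 < expect R G → 0 ≤ expect R' G := by
    intro G hG h0
    rcases (h'.mem_desirable_iff hk hG).mp ((h.mem_desirable_iff hk hG).mpr (Or.inr h0))
      with h1 | h1
    · exact hR'.expect_nonneg h1.1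
    · exact h1.le
  have hG : IsGamble (R' - R) := hR'.1.sub hR.1
  have h1 := eq_mul_of_forall_pos_imp_nonneg (S := gambleSubmodule k n) isGamble_one
    hR.expect_one hpos hG
  rw [hR'.expect_one, mul_one] at h1
  have h2 : ((R' - R)ᴴ * (R' - R)).trace = 0 := by
    rw [expect_apply, expect_apply, ← sub_eq_zero, ← Complex.sub_re, ← Matrix.trace_sub,
      ← mul_sub] at h1
    rw [hG.1.eq]
    have h3 := (Matrix.posSemidef_conjTranspose_mul_self (R' - R)).trace_nonneg
    rw [hG.1.eq] at h3
    exact Complex.ext h1 (Complex.nonneg_iff.mp h3).2.symm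
  exact sub_eq_zero.mp (Matrix.trace_conjTranspose_mul_self_eq_zero_iff.mp h2)

end States

/-! ### Epistemic irrelevance and the product form -/

section Factorization

variable {k n : ℕ}

/-- The linear map `g ↦ g ⊗ E`. -/
def diagKronecker (E : Matrix (Fin n) (Fin n) ℂ) :
    (Fin k → ℝ) →ₗ[ℝ] Matrix (Fin k × Fin n) (Fin k × Fin n) ℂ where
  toFun g := diagC g ⊗ₖ E
  map_add' g h := by
    simp only [diagC_kronecker, ← ofBlocks_add]
    congr 1
    funext i
    exact add_smul _ _ _
  map_smul' c g := by
    simp only [diagC_kronecker, ← ofBlocks_smul]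
    congr 1
    funext i
    exact mul_smul _ _ _

theorem expect_diagKronecker {R : Matrix (Fin k × Fin n) (Fin k × Fin n) ℂ} (hR : IsGamble R)
    (E : Matrix (Fin n) (Fin n) ℂ) (g : Fin k → ℝ) :
    expect R (diagKronecker E g) = ∑ i, g i * (E * block R i).trace.re := by
  rw [expect_apply]
  conv_lhs => rw [← hR.ofBlocks_block]
  change (diagC g ⊗ₖ E * _).trace.re = _
  rw [diagC_kronecker, ofBlocks_mul, trace_ofBlocks, Complex.re_sum]
  simp [Matrix.trace_smul]

theorem diagKronecker_one : diagKronecker (1 : Matrix (Fin n) (Fin n) ℂ) (1 : Fin k → ℝ) = 1 := by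
  change diagC 1 ⊗ₖ 1 = _
  rw [diagC_kronecker, ← ofBlocks_one]
  congr 1
  funext i
  simp

theorem isGamble_diagKronecker {E : Matrix (Fin n) (Fin n) ℂ} (hE : E.IsHermitian)
    (g : Fin k → ℝ) : IsGamble (diagKronecker E g) := by
  change IsGamble (diagC g ⊗ₖ E)
  rw [diagC_kronecker]
  exact isGamble_ofBlocks fun i => hE.real_smul _

theorem compress_diagKronecker_one {E : Matrix (Fin n) (Fin n) ℂ} (hE : E * E = E)
    (g : Fin k → ℝ) : compress E (diagKronecker 1 g) = diagKronecker E g := by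
  change compress E (diagC g ⊗ₖ 1) = diagC g ⊗ₖ E
  rw [diagC_kronecker, compress_ofBlocks, diagC_kronecker]
  congr 1
  funext i
  rw [Matrix.mul_smul, Matrix.smul_mul, mul_one, hE]

theorem compress_posSemidef {E : Matrix (Fin n) (Fin n) ℂ} (hE : E.IsHermitian)
    {G : Matrix (Fin k × Fin n) (Fin k × Fin n) ℂ} (hG : G.PosSemidef) :
    (compress E G).PosSemidef := by
  have h := hG.mul_mul_conjTranspose_same ((1 : Matrix (Fin k) (Fin k) ℂ) ⊗ₖ E)
  rwa [Matrix.conjTranspose_kronecker, hE.eq, Matrix.conjTranspose_one] at h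

/-- Epistemic irrelevance forces the blocks of the representing state to be proportional. -/
theorem block_eq_smul_of_epistemicIrrelevance (hk : 1 ≤ k) {succ : QL k n → QL k n → Prop}
    (hirr : EpistemicIrrelevance succ) {R : Matrix (Fin k × Fin n) (Fin k × Fin n) ℂ}
    (hR : IsState R) (h : IsRepresentedBy succ R) (i : Fin k) :
    block R i = (block R i).trace.re • ∑ j, block R j := by
  apply eq_of_unit_star_dotProduct
  intro u hu
  obtain ⟨E, l, hE, hl⟩ := exists_isMeasurement hu
  have hEl := (hE.posSemidef l).1
  have hpos : ∀ g ∈ (⊤ : Submodule ℝ (Fin k → ℝ)),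
      0 < (expect R ∘ₗ diagKronecker 1) g → 0 ≤ (expect R ∘ₗ diagKronecker (E l)) g := by
    intro g _ hg
    rw [LinearMap.comp_apply] at hg ⊢
    have h1 : g ∈ marg (desirable succ) :=
      (h.mem_desirable_iff hk (isGamble_diagKronecker Matrix.isHermitian_one g)).mpr (Or.inr hg)
    rw [hirr E hE l] at h1
    rcases h1.2 with h2 | h2
    · rw [← compress_diagKronecker_one (hE.idem l)]
      exact hR.expect_nonneg (compress_posSemidef hEl h2.1)
    · change compress (E l) (diagKronecker 1 g) ∈ _ at h2
      rw [compress_diagKronecker_one (hE.idem l),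
        h.mem_desirable_iff hk (isGamble_diagKronecker hEl g)] at h2
      rcases h2 with h2 | h2
      · exact hR.expect_nonneg h2.1
      · exact h2.le
  -- At g = 1 the functional for I has value 1 and the one for uu* has value Re u*(∑ R_j)u; the i-th
  -- coordinate vector extracts block i.
  have key := eq_mul_of_forall_pos_imp_nonneg (e := 1) Submodule.mem_top
    (by rw [LinearMap.comp_apply, diagKronecker_one, hR.expect_one]) hpos
    (x := Pi.single i 1) Submodule.mem_top
  simp only [LinearMap.comp_apply, expect_diagKronecker hR.1, one_mul, Pi.one_apply,
    Pi.single_apply, ite_mul, zero_mul, Finset.sum_ite_eq', Finset.mem_univ, if_true, hl,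
    trace_vecMulVec_star_mul] at key
  -- The proportionality concerns real parts; Hermitian forms have no imaginary part.
  have him (j : Fin k) := (hR.1.isHermitian_block j).im_star_dotProduct_mulVec_self u
  rw [Matrix.smul_mulVec, dotProduct_smul, Matrix.sum_mulVec, dotProduct_sum]
  apply Complex.ext
  · rw [key, Complex.smul_re, Complex.re_sum, smul_eq_mul]
  · rw [Complex.smul_im, Complex.im_sum]
    simp only [RCLike.im_to_complex] at him
    simp [him]

theorem isState_diagC_kronecker {p : Fin k → ℝ} {ρ : Matrix (Fin n) (Fin n) ℂ}
    (hp : p ∈ stdSimplex ℝ (Fin k)) (hρ : IsDensity ρ) : IsState (diagC p ⊗ₖ ρ) := by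
  rw [diagC_kronecker]
  refine ⟨isGamble_ofBlocks fun i => hρ.1.1.real_smul _,
    ofBlocks_posSemidef fun i => hρ.1.real_smul (hp.1 i), ?_⟩
  simp only [trace_ofBlocks, Matrix.trace_smul, hρ.2, ← Finset.sum_smul, hp.2, one_smul]

/-- Tr((∑ p_i P_i†) ρ) is the blockwise expansion of Tr(Proj(P)† (p ⊗ ρ)), so uniqueness of the pair
reduces to uniqueness of the state. -/
theorem representsSI_iff {succ : QL k n → QL k n → Prop} {p : Fin k → ℝ}
    {ρ : Matrix (Fin n) (Fin n) ℂ} :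
    RepresentsSI succ p ρ ↔ IsRepresentedBy succ (diagC p ⊗ₖ ρ) := by
  have h (P : QL k n) : (utility p P * ρ).trace = ((proj P.1)ᴴ * (diagC p ⊗ₖ ρ)).trace := by
    rw [P.proj_eq, conjTranspose_ofBlocks, diagC_kronecker, ofBlocks_mul, trace_ofBlocks, utility,
      Finset.sum_mul, Matrix.trace_sum]
    simp only [Matrix.smul_mul, Matrix.mul_smul]
  unfold RepresentsSI IsRepresentedBy
  simp only [h]

/-- The traces of the blocks recover p, and their sum recovers ρ. -/
theorem eq_and_eq_of_diagC_kronecker_eq {p p' : Fin k → ℝ} {ρ ρ' : Matrix (Fin n) (Fin n) ℂ}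
    (hp : p ∈ stdSimplex ℝ (Fin k)) (hp' : p' ∈ stdSimplex ℝ (Fin k)) (hρ : IsDensity ρ)
    (hρ' : IsDensity ρ') (h : diagC p' ⊗ₖ ρ' = diagC p ⊗ₖ ρ) : p' = p ∧ ρ' = ρ := by
  rw [diagC_kronecker, diagC_kronecker] at h
  have h1 (i : Fin k) : p' i • ρ' = p i • ρ := congrFun (ofBlocks_injective h) i
  constructor
  · funext i
    have h2 := congrArg Matrix.trace (h1 i)
    rw [Matrix.trace_smul, Matrix.trace_smul, hρ.2, hρ'.2] at h2
    simpa using h2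
  · have h2 : ∑ i, p' i • ρ' = ∑ i, p i • ρ := Finset.sum_congr rfl fun i _ => h1 i
    rwa [← Finset.sum_smul, ← Finset.sum_smul, hp.2, hp'.2, one_smul, one_smul] at h2

end Factorization

end QuantumPref

/-! ### The state-independent representation -/

open QuantumPref
theorem mainTheorem6 (k n : ℕ) (hk : 1 ≤ k) (hn : 1 ≤ n)
    (succ : QL k n → QL k n → Prop)
    (hsucc : IsCompleteWACoherent succ)
    (hirr : EpistemicIrrelevance succ) :
    ∃ (R : Matrix (Fin k × Fin n) (Fin k × Fin n) ℂ)
      (p : Fin k → ℝ) (ρ : Matrix (Fin n) (Fin n) ℂ),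
      (IsState R ∧ IsRepresentedBy succ R ∧
        ∀ R', IsState R' → IsRepresentedBy succ R' → R' = R) ∧
      (p ∈ stdSimplex ℝ (Fin k) ∧ IsDensity ρ ∧ R = diagC p ⊗ₖ ρ ∧ RepresentsSI succ p ρ) ∧
      ∀ p' ρ', p' ∈ stdSimplex ℝ (Fin k) → IsDensity ρ' → RepresentsSI succ p' ρ' →
        p' = p ∧ ρ' = ρ := by
  obtain ⟨R, hR, hrep⟩ := exists_isRepresentedBy hk hn hsucc
  have huniq : ∀ R', IsState R' → IsRepresentedBy succ R' → R' = R :=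
    fun R' hR' hrep' => hrep.unique hk hR hR' hrep'
  have htr : ∑ i, (block R i).trace = 1 := by
    rw [← trace_ofBlocks, hR.1.ofBlocks_block, hR.2.2]
  -- The factors are the two marginals of R: block traces for p, the sum of blocks for ρ.
  have hp : (fun i => (block R i).trace.re) ∈ stdSimplex ℝ (Fin k) := by
    refine ⟨fun i => (Complex.nonneg_iff.mp (block_posSemidef hR.2.1 i).trace_nonneg).1, ?_⟩
    rw [← Complex.re_sum, htr, Complex.one_re]
  have hρ : IsDensity (∑ j, block R j) :=
    ⟨Matrix.posSemidef_sum _ fun i _ => block_posSemidef hR.2.1 i, by rw [Matrix.trace_sum, htr]⟩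
  have hfac : R = diagC (fun i => (block R i).trace.re) ⊗ₖ ∑ j, block R j := by
    rw [diagC_kronecker]
    conv_lhs => rw [← hR.1.ofBlocks_block]
    congr 1
    funext i
    exact block_eq_smul_of_epistemicIrrelevance hk hirr hR hrep i
  refine ⟨R, _, _, ⟨hR, hrep, huniq⟩, ⟨hp, hρ, hfac, ?_⟩, fun p' ρ' hp' hρ' h' => ?_⟩
  · rw [representsSI_iff, ← hfac]
    exact hrep
  · refine eq_and_eq_of_diagC_kronecker_eq hp hp' hρ hρ' ?_
    rw [← hfac]
    exact huniq _ (isState_diagC_kronecker hp' hρ') (representsSI_iff.mp h')
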